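/- Let $\log$ be the branch of the complex logarithm that is analytic on $\mathbb{C}$ cut along the negative imaginary axis and takes the value $0$ at $1$. For real $x\neq 0$ and $w\in\mathbb{C}$ put $x^w=e^{w\log x}$, and put $0^w=0$ if $\operatorname{Re} w>0$. For real $\mu>-1$, $n\ge 1$ and pairwise distinct real numbers $a_1,\dots,a_n$, not all zero, define the complete homogeneous symmetric polynomial of fractional degree $\mu$ by Jacobi's bialternant formula $$h_\mu(a_1,\dots,a_n)=\frac{\det\begin{bmatrix}1&a_1&\cdots&a_1^{n-2}&a_1^{\mu+n-1}\\ \vdots&\vdots&&\vdots&\vdots\\ 1&a_n&\cdots&a_n^{n-2}&a_n^{\mu+n-1}\end{bmatrix}}{\prod_{1\le i<j\le n}(a_j-a_i)},$$ and for the remaining vectors $(a_1,\dots,a_n)\in\mathbb{R}^n\setminus\{(0,\dots,0)\}$ define $h_\mu(a_1,\dots,a_n)$ as the limit of $h_\mu(b_1,\dots,b_n)$ as $(b_1,\dots,b_n)\to(a_1,\dots,a_n)$ through vectors with pairwise distinct entries. Then for every real $\mu>-1$ and every $(a_1,\dots,a_n)\in\mathbb{R}^n\setminus\{(0,\dots,0)\}$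 the limit of $h_\mu(b_1,\dots,b_n)$ as $(b_1,\dots,b_n)\to(a_1,\dots,a_n)$ through vectors with pairwise distinct entries exists and equals $h_\mu(a_1,\dots,a_n)$ (so that $h_\mu$ is well defined), and the following hold. (a) If $|\mu-2p|<\tfrac12$ for some integer $p\ge 0$, then $\operatorname{Re}h_\mu(a_1,\dots,a_n)>0$. (b) If $|\mu-(2p-1)|<\tfrac12$ for some integer $p\ge 0$, then $\operatorname{Re}h_\mu(a_1,\dots,a_n)>0$ if $(a_1,\dots,a_n)\in[0,\infty)^n$, and $\operatorname{Re}h_\mu(a_1,\dots,a_n)<0$ if $(a_1,\dots,a_n)\in(-\infty,0]^n$. (c) If $|\mu-p|=\tfrac12$ for some integer $p\ge 0$, then $\operatorname{Re}h_\mu(a_1,\dots,a_n)\ge 0$, and $\operatorname{Re}h_\mu(a_1,\dots,a_n)=0$ if $(a_1,\dots,a_n)\in(-\infty,0]^n$. -/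

import Mathlib

open Filter Topology

noncomputable section

/-- The branch of the complex logarithm with cut along the negative imaginary axis,
normalised to take the value `0` at `1`; its imaginary part lies in `(-π/2, 3π/2]`. -/
def branchLog (w : ℂ) : ℂ :=
  Complex.log (-Complex.I * w) + (Real.pi / 2 : ℝ) * Complex.I

/-- `branchLog` is a logarithm. -/
theorem exp_branchLog {w : ℂ} (hw : w ≠ 0) : Complex.exp (branchLog w) = w := by
  have h1 : -Complex.I * w ≠ 0 := mul_ne_zero (neg_ne_zero.mpr Complex.I_ne_zero) hw
  have h2 : Complex.exp ((Real.pi / 2 : ℝ) * Complex.I) = Complex.I := by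
    push_cast
    exact Complex.exp_pi_div_two_mul_I
  rw [branchLog, Complex.exp_add, Complex.exp_log h1, h2]
  linear_combination (-w) * Complex.I_mul_I

theorem branchLog_one : branchLog 1 = 0 := by
  rw [branchLog, mul_one, Complex.log_neg_I]
  push_cast
  ring

/-- `branchLog` is analytic off the closed negative imaginary axis. -/
theorem analyticOnNhd_branchLog :
    AnalyticOnNhd ℂ branchLog {w : ℂ | ¬ (w.re = 0 ∧ w.im ≤ 0)} := by
  intro w hw
  have h : -Complex.I * w ∈ Complex.slitPlane := by
    rw [Complex.mem_slitPlane_iff]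
    by_contra hc
    push Not at hc
    obtain ⟨h1, h2⟩ := hc
    simp at h1 h2
    exact hw ⟨h2, h1⟩
  exact ((analyticAt_const.mul analyticAt_id).clog h).add analyticAt_const

/-- The power `x ^ w = exp (w log x)` of a nonzero real number for the above branch, together
with the convention `0 ^ w = 0` (only used for `Re w > 0`). -/
def branchPow (x : ℝ) (w : ℂ) : ℂ :=
  if x = 0 then 0 else Complex.exp (w * branchLog (x : ℂ))

/-- The `n × n` matrix with rows `1, a_i, a_i ^ 2, …, a_i ^ (n - 2), a_i ^ (z + n - 1)`. -/
def jacobiMatrix {n : ℕ} (z : ℂ) (a : Fin n → ℝ) : Matrix (Fin n) (Fin n) ℂ :=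
  Matrix.of fun i j =>
    if (j : ℕ) + 1 = n then branchPow (a i) (z + n - 1) else (a i : ℂ) ^ (j : ℕ)

/-- Jacobi's bialternant quotient; meaningful for pairwise distinct `a_i`, when the Vandermonde
determinant does not vanish. -/
def bialternant {n : ℕ} (z : ℂ) (a : Fin n → ℝ) : ℂ :=
  (jacobiMatrix z a).det / (Matrix.vandermonde fun i => (a i : ℂ)).det

open Classical in
/-- The complete homogeneous symmetric polynomial `h_z (a_1, …, a_n)` of fractional degree `z`:
given by the bialternant quotient if the `a_i` are pairwise distinct, and by the limit of the
bialternant quotients at vectors with pairwise distinct entries tending to `a` otherwise. -/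
def fracHsymm {n : ℕ} (z : ℂ) (a : Fin n → ℝ) : ℂ :=
  if Function.Injective a then bialternant z a
  else limUnder (𝓝[{b : Fin n → ℝ | Function.Injective b}] a) (bialternant z)

end

noncomputable section

open MeasureTheory

/-! For independent standard exponential variables $E_i$ and distinct $a_i$ one has
$\Gamma(\mu+1)\,h_\mu(a)=\mathbb E\big[(\sum_i a_iE_i)^\mu\big]$, so the sign of
$\operatorname{Re}h_\mu$ is read off from $\operatorname{Re}x^\mu$, which is $x^\mu$ for $x>0$ and
$|x|^\mu\cos(\mu\pi)$ for $x<0$.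

The moment formula is `integral_branchPow_linForm`. Partial fractions of the characteristic function
$\prod_i(1-ia_it)^{-1}$ write the law of $\sum a_iE_i$ as a signed combination of the laws of the
$a_iE_i$ (`linLaw_add_sum_eq`); integrating $x^\mu$ gives a divided difference, which is the
bialternant by Cramer's rule (`bialternant_eq_divDiff`).

For $\mu>0$ the moment is continuous in $a$ by dominated convergence. The recurrence `mul_divDiff`
carries the existence of limits down to $\mu>-1$ at every $a\ne0$ (`exists_tendsto_divDiff`). Strict
signs survive the limit because the integrands stay bounded below on a fixed open set of positive
mass (`mul_re_pos_of_tendsto_divDiff`). -/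

theorem branchLog_ofReal_of_pos {x : ℝ} (hx : 0 < x) : branchLog (x : ℂ) = (Real.log x : ℂ) := by
  have h : -Complex.I * (x : ℂ) = ((x : ℝ) : ℂ) * -Complex.I := by ring
  rw [branchLog, h, Complex.log_ofReal_mul hx (by simp), Complex.log_neg_I]
  push_cast
  ring

theorem branchLog_ofReal_of_neg {x : ℝ} (hx : x < 0) :
    branchLog (x : ℂ) = (Real.log (-x) : ℂ) + Real.pi * Complex.I := by
  have h : -Complex.I * (x : ℂ) = ((-x : ℝ) : ℂ) * Complex.I := by push_cast; ring
  rw [branchLog, h, Complex.log_ofReal_mul (neg_pos.2 hx) (by simp), Complex.log_I]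
  push_cast
  ring

/-! ### Real powers of real numbers for the chosen branch -/

theorem branchPow_zero_left (w : ℂ) : branchPow 0 w = 0 := by simp [branchPow]

theorem branchPow_of_pos {x : ℝ} (hx : 0 < x) (ν : ℝ) :
    branchPow x (ν : ℂ) = ((x ^ ν : ℝ) : ℂ) := by
  rw [branchPow, if_neg hx.ne', branchLog_ofReal_of_pos hx, Real.rpow_def_of_pos hx]
  push_cast
  rw [mul_comm]

theorem branchPow_of_neg {x : ℝ} (hx : x < 0) (ν : ℝ) :
    branchPow x (ν : ℂ) = (((-x) ^ ν : ℝ) : ℂ) * Complex.exp ((ν * Real.pi : ℝ) * Complex.I) := by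
  rw [branchPow, if_neg hx.ne, branchLog_ofReal_of_neg hx, Real.rpow_def_of_pos (neg_pos.2 hx),
    Complex.ofReal_exp, ← Complex.exp_add]
  congr 1
  push_cast
  ring

theorem branchPow_add_one (x : ℝ) (w : ℂ) : branchPow x (w + 1) = x * branchPow x w := by
  unfold branchPow
  split_ifs with h
  · simp
  · rw [add_mul, one_mul, Complex.exp_add, exp_branchLog (by exact_mod_cast h), mul_comm]

theorem branchPow_add_natCast (x : ℝ) (w : ℂ) (m : ℕ) :
    branchPow x (w + m) = (x : ℂ) ^ m * branchPow x w := by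
  induction m with
  | zero => simp
  | succ m ih =>
    rw [Nat.cast_succ, ← add_assoc, branchPow_add_one, ih, pow_succ]
    ring

/-- Homogeneity under positive scaling reduces every moment of $aE$ to a Gamma integral. -/
theorem branchPow_mul_of_pos (a : ℝ) {x : ℝ} (hx : 0 < x) (ν : ℝ) :
    branchPow (a * x) (ν : ℂ) = branchPow a ν * ((x ^ ν : ℝ) : ℂ) := by
  rcases lt_trichotomy a 0 with ha | rfl | ha
  · rw [branchPow_of_neg (mul_neg_of_neg_of_pos ha hx), branchPow_of_neg ha, ← neg_mul,
      Real.mul_rpow (neg_pos.2 ha).le hx.le]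
    push_cast
    ring
  · simp [branchPow_zero_left]
  · rw [branchPow_of_pos (mul_pos ha hx), branchPow_of_pos ha, Real.mul_rpow ha.le hx.le]
    push_cast
    ring

theorem re_branchPow_of_pos {x : ℝ} (hx : 0 < x) (ν : ℝ) : (branchPow x (ν : ℂ)).re = x ^ ν := by
  rw [branchPow_of_pos hx, Complex.ofReal_re]

theorem re_branchPow_of_neg {x : ℝ} (hx : x < 0) (ν : ℝ) :
    (branchPow x (ν : ℂ)).re = (-x) ^ ν * Real.cos (ν * Real.pi) := by
  rw [branchPow_of_neg hx, Complex.re_ofReal_mul, Complex.exp_ofReal_mul_I_re]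

theorem norm_branchPow_le (x ν : ℝ) : ‖branchPow x (ν : ℂ)‖ ≤ |x| ^ ν := by
  rcases lt_trichotomy x 0 with hx | rfl | hx
  · rw [branchPow_of_neg hx, norm_mul, Complex.norm_exp_ofReal_mul_I, mul_one, Complex.norm_real,
      Real.norm_of_nonneg (Real.rpow_nonneg (neg_pos.2 hx).le _), abs_of_neg hx]
  · rw [branchPow_zero_left, norm_zero]
    positivity
  · rw [branchPow_of_pos hx, Complex.norm_real,
      Real.norm_of_nonneg (Real.rpow_nonneg hx.le _), abs_of_pos hx]

theorem continuousAt_branchPow {x : ℝ} (hx : x ≠ 0) (ν : ℝ) :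
    ContinuousAt (fun y : ℝ => branchPow y (ν : ℂ)) x := by
  rcases hx.lt_or_gt with hx | hx
  · have h : (fun y : ℝ => branchPow y (ν : ℂ)) =ᶠ[𝓝 x] fun y =>
        (((-y) ^ ν : ℝ) : ℂ) * Complex.exp ((ν * Real.pi : ℝ) * Complex.I) := by
      filter_upwards [gt_mem_nhds hx] with y hy using branchPow_of_neg hy ν
    refine ContinuousAt.congr ?_ h.symm
    refine (Complex.continuous_ofReal.continuousAt.comp ?_).mul continuousAt_const
    exact (continuousAt_neg (x := x)).rpow_const (Or.inl (neg_pos.2 hx).ne')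
  · have h : (fun y : ℝ => branchPow y (ν : ℂ)) =ᶠ[𝓝 x] fun y => ((y ^ ν : ℝ) : ℂ) := by
      filter_upwards [lt_mem_nhds hx] with y hy using branchPow_of_pos hy ν
    refine ContinuousAt.congr ?_ h.symm
    exact Complex.continuous_ofReal.continuousAt.comp
      (continuousAt_id.rpow_const (Or.inl hx.ne'))

theorem continuous_branchPow {ν : ℝ} (hν : 0 < ν) :
    Continuous fun y : ℝ => branchPow y (ν : ℂ) := by
  refine continuous_iff_continuousAt.2 fun x => ?_
  rcases eq_or_ne x 0 with rfl | hx
  · rw [ContinuousAt, branchPow_zero_left]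
    refine squeeze_zero_norm (fun y => norm_branchPow_le y ν) ?_
    have h : ContinuousAt (fun y : ℝ => |y| ^ ν) 0 :=
      continuous_abs.continuousAt.rpow_const (Or.inr hν.le)
    simpa [ContinuousAt, Real.zero_rpow hν.ne'] using h
  · exact continuousAt_branchPow hx ν

theorem measurable_branchPow (ν : ℝ) : Measurable fun y : ℝ => branchPow y (ν : ℂ) := by
  unfold branchPow branchLog
  refine Measurable.ite (measurableSet_singleton 0) measurable_const ?_
  fun_prop

/-! ### The exponential distribution: characteristic function and moments -/

/-- The standard exponential distribution. -/
def stdExp : Measure ℝ :=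
  (volume.restrict (Set.Ioi 0)).withDensity fun x => ENNReal.ofReal (Real.exp (-x))

theorem integral_stdExp (f : ℝ → ℂ) :
    ∫ x, f x ∂stdExp = ∫ x in Set.Ioi (0 : ℝ), (Real.exp (-x) : ℂ) * f x := by
  rw [stdExp, integral_withDensity_eq_integral_toReal_smul (by fun_prop) (by simp)]
  refine integral_congr_ae (ae_of_all _ fun x => ?_)
  simp [ENNReal.toReal_ofReal (Real.exp_pos _).le]

theorem integrable_stdExp_iff {f : ℝ → ℂ} :
    Integrable f stdExp ↔ IntegrableOn (fun x => (Real.exp (-x) : ℂ) * f x) (Set.Ioi 0) := by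
  rw [stdExp, integrable_withDensity_iff_integrable_smul' (by fun_prop) (by simp)]
  refine integrable_congr (ae_of_all _ fun x => ?_)
  simp [ENNReal.toReal_ofReal (Real.exp_pos _).le]

instance isProbabilityMeasure_stdExp : IsProbabilityMeasure stdExp := by
  constructor
  rw [stdExp, withDensity_apply _ MeasurableSet.univ, Measure.restrict_univ,
    ← ofReal_integral_eq_lintegral_ofReal]
  · rw [integral_exp_neg_Ioi]
    simp
  · exact integrableOn_exp_neg_Ioi 0
  · exact ae_of_all _ fun x => (Real.exp_pos _).le

theorem ae_stdExp_pos : ∀ᵐ x ∂stdExp, 0 < x :=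
  (withDensity_absolutelyContinuous _ _).ae_le (ae_restrict_mem measurableSet_Ioi)

theorem stdExp_pos_of_isOpen {U : Set ℝ} (hU : IsOpen U) {x : ℝ} (hx : x ∈ U) (h0 : 0 < x) :
    0 < stdExp U := by
  rw [pos_iff_ne_zero, stdExp, Ne, withDensity_apply_eq_zero (by fun_prop)]
  have h : {y : ℝ | ENNReal.ofReal (Real.exp (-y)) ≠ 0} = Set.univ := by
    ext y
    simp [Real.exp_pos]
  rw [h, Set.univ_inter, Measure.restrict_apply hU.measurableSet]
  exact ((hU.inter isOpen_Ioi).measure_pos volume ⟨x, hx, h0⟩).ne'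

theorem integral_exp_mul_I_stdExp (t : ℝ) :
    ∫ x : ℝ, Complex.exp (t * x * Complex.I) ∂stdExp = (1 - t * Complex.I)⁻¹ := by
  have h0 : (1 : ℂ) - t * Complex.I ≠ 0 := by
    intro h
    simpa using congrArg Complex.re h
  have h : ∀ x : ℝ, (Real.exp (-x) : ℂ) * Complex.exp (t * x * Complex.I) =
      Complex.exp ((-(1 - t * Complex.I)) * x) := fun x => by
    rw [Complex.ofReal_exp, ← Complex.exp_add]
    congr 1
    push_cast
    ring
  rw [integral_stdExp]
  simp_rw [h]
  rw [integral_exp_mul_complex_Ioi (by simp)]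
  simp [neg_div_neg_eq, -neg_sub]

theorem integrable_rpow_stdExp {ν : ℝ} (hν : -1 < ν) :
    Integrable (fun x : ℝ => ((x ^ ν : ℝ) : ℂ)) stdExp := by
  rw [integrable_stdExp_iff]
  have h := (Real.GammaIntegral_convergent (s := ν + 1) (by linarith)).ofReal (𝕜 := ℂ)
  simpa [IntegrableOn] using h

theorem integral_rpow_stdExp {ν : ℝ} (hν : -1 < ν) :
    ∫ x : ℝ, ((x ^ ν : ℝ) : ℂ) ∂stdExp = (Real.Gamma (ν + 1) : ℂ) := by
  rw [integral_stdExp, Real.Gamma_eq_integral (by linarith), ← integral_complex_ofReal]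
  simp

theorem integrable_branchPow_stdExp {ν : ℝ} (hν : -1 < ν) (a : ℝ) :
    Integrable (fun x : ℝ => branchPow (a * x) (ν : ℂ)) stdExp :=
  ((integrable_rpow_stdExp hν).const_mul (branchPow a ν)).congr <| by
    filter_upwards [ae_stdExp_pos] with x hx using (branchPow_mul_of_pos a hx ν).symm

theorem integral_branchPow_stdExp {ν : ℝ} (hν : -1 < ν) (a : ℝ) :
    ∫ x : ℝ, branchPow (a * x) (ν : ℂ) ∂stdExp = Real.Gamma (ν + 1) * branchPow a ν := by
  rw [mul_comm, ← integral_rpow_stdExp hν, ← integral_const_mul]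
  refine integral_congr_ae ?_
  filter_upwards [ae_stdExp_pos] with x hx using branchPow_mul_of_pos a hx ν

/-! ### Laws of linear forms in exponentials and their partial fractions -/

/-- The linear form with coefficients `a i`, `i ∈ s`. -/
def linForm {ι : Type*} (s : Finset ι) (a x : ι → ℝ) : ℝ := ∑ i ∈ s, a i * x i

theorem continuous_linForm {ι : Type*} (s : Finset ι) (a : ι → ℝ) : Continuous (linForm s a) := by
  unfold linForm
  fun_prop

/-- The product of standard exponential distributions. -/
abbrev piExp (ι : Type*) [Fintype ι] : Measure (ι → ℝ) := Measure.pi fun _ => stdExp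

/-- The law of `∑ i ∈ s, a i * E i` for independent standard exponential variables `E i`. -/
def linLaw {ι : Type*} [Fintype ι] (s : Finset ι) (a : ι → ℝ) : Measure ℝ := (piExp ι).map (linForm s a)

instance {ι : Type*} [Fintype ι] (s : Finset ι) (a : ι → ℝ) : IsProbabilityMeasure (linLaw s a) :=
  Measure.isProbabilityMeasure_map (continuous_linForm s a).measurable.aemeasurable

theorem charFun_linLaw {ι : Type*} [Fintype ι] [DecidableEq ι] (s : Finset ι) (a : ι → ℝ) (t : ℝ) :
    charFun (linLaw s a) t = ∏ i ∈ s, (1 - a i * (t * Complex.I))⁻¹ := by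
  rw [charFun_apply_real, linLaw, integral_map (continuous_linForm s a).measurable.aemeasurable
    (by fun_prop)]
  have h : ∀ x : ι → ℝ, Complex.exp (t * linForm s a x * Complex.I) =
      ∏ i, if i ∈ s then Complex.exp (((t * a i : ℝ) : ℂ) * x i * Complex.I) else 1 := fun x => by
    rw [Finset.prod_ite_mem, Finset.univ_inter, ← Complex.exp_sum, linForm]
    push_cast
    rw [Finset.mul_sum, Finset.sum_mul]
    congr 1
    refine Finset.sum_congr rfl fun i _ => by ring
  simp_rw [h]
  rw [integral_fintype_prod_eq_prod (μ := fun _ => stdExp)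
    (fun i (y : ℝ) => if i ∈ s then Complex.exp (((t * a i : ℝ) : ℂ) * y * Complex.I) else 1)]
  have h' : ∀ i, (∫ y : ℝ, (if i ∈ s then Complex.exp (((t * a i : ℝ) : ℂ) * y * Complex.I)
      else 1) ∂stdExp) = if i ∈ s then (1 - a i * (t * Complex.I))⁻¹ else 1 := fun i => by
    split_ifs
    · rw [integral_exp_mul_I_stdExp]
      push_cast
      ring
    · simp
  simp_rw [h']
  rw [Finset.prod_ite_mem, Finset.univ_inter]

/-- The coefficients of the partial fraction expansion of `∏ i ∈ s, (1 - a i * w)⁻¹`. -/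
def fracCoeff {ι : Type*} [DecidableEq ι] (s : Finset ι) (a : ι → ℝ) (i : ι) : ℝ :=
  a i ^ (s.card - 1) / ∏ j ∈ s.erase i, (a i - a j)

/-- With $k$ the size of `s`, $X^{k-1}$ is its own Lagrange interpolant at the nodes $a_i$.
Evaluating at $w^{-1}$ and multiplying by $w^{k-1}$ gives the identity; at $w=0$ it is the
comparison of leading coefficients. -/
theorem sum_fracCoeff_mul_prod {ι : Type*} [DecidableEq ι] {s : Finset ι} (hs : s.Nonempty) {a : ι → ℝ}
    (ha : Set.InjOn a s) (w : ℂ) :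
    ∑ i ∈ s, (fracCoeff s a i : ℂ) * ∏ j ∈ s.erase i, (1 - a j * w) = 1 := by
  have hinj : Set.InjOn (fun i => (a i : ℂ)) s := fun i hi j hj h =>
    ha hi hj (Complex.ofReal_injective h)
  have hdeg : (Polynomial.X ^ (s.card - 1) : Polynomial ℂ).degree < s.card := by
    rw [Polynomial.degree_X_pow]
    exact_mod_cast Nat.sub_lt hs.card_pos one_pos
  rcases eq_or_ne w 0 with rfl | hw
  · have h := Lagrange.coeff_eq_sum hinj hdeg
    simp only [Polynomial.coeff_X_pow, if_true, Polynomial.eval_pow, Polynomial.eval_X] at h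
    refine Eq.trans (Finset.sum_congr rfl fun i _ => ?_) h.symm
    simp [fracCoeff]
  · have h := congrArg (Polynomial.eval w⁻¹) (Lagrange.eq_interpolate hinj hdeg)
    rw [Lagrange.interpolate_eq_sum, Polynomial.eval_finsetSum] at h
    simp only [Polynomial.eval_pow, Polynomial.eval_X, Polynomial.eval_mul, Polynomial.eval_C,
      Polynomial.eval_prod, Polynomial.eval_sub] at h
    have h2 := congrArg (fun z => w ^ (s.card - 1) * z) h
    simp only [← mul_pow, mul_inv_cancel₀ hw, one_pow, Finset.mul_sum] at h2
    refine Eq.trans (Finset.sum_congr rfl fun i hi => ?_) h2.symm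
    have hprod : w ^ (s.card - 1) * ∏ j ∈ s.erase i, (w⁻¹ - a j) =
        ∏ j ∈ s.erase i, (1 - a j * w) := by
      rw [← Finset.card_erase_of_mem hi, ← Finset.prod_const, ← Finset.prod_mul_distrib]
      refine Finset.prod_congr rfl fun j _ => ?_
      rw [mul_sub, mul_inv_cancel₀ hw, mul_comm w]
    rw [← hprod, fracCoeff]
    push_cast
    ring

theorem prod_inv_one_sub_eq {ι : Type*} [DecidableEq ι] {s : Finset ι} (hs : s.Nonempty) {a : ι → ℝ}
    (ha : Set.InjOn a s) (t : ℝ) :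
    ∏ i ∈ s, (1 - a i * (t * Complex.I))⁻¹ =
      ∑ i ∈ s, (fracCoeff s a i : ℂ) * (1 - a i * (t * Complex.I))⁻¹ := by
  have h0 : ∀ i, (1 : ℂ) - a i * (t * Complex.I) ≠ 0 := fun i h => by
    simpa using congrArg Complex.re h
  refine (mul_one _).symm.trans ?_
  refine (congrArg _ (sum_fracCoeff_mul_prod hs ha (t * Complex.I)).symm).trans ?_
  rw [Finset.mul_sum]
  refine Finset.sum_congr rfl fun i hi => ?_
  have h1 : ∏ j ∈ s.erase i, (1 - (a j : ℂ) * (t * Complex.I)) ≠ 0 :=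
    Finset.prod_ne_zero_iff.2 fun j _ => h0 j
  rw [Finset.prod_inv_distrib, ← Finset.mul_prod_erase s _ hi]
  have h2 := h0 i
  generalize ∏ j ∈ s.erase i, (1 - (a j : ℂ) * (t * Complex.I)) = y at h1 ⊢
  generalize (1 : ℂ) - a i * (t * Complex.I) = z at h2 ⊢
  field_simp

theorem integral_sum_smul_measure {ι : Type*} (s : Finset ι) (c : ι → NNReal)
    {m : ι → Measure ℝ} {f : ℝ → ℂ} (hf : ∀ i ∈ s, Integrable f (m i)) :
    ∫ x, f x ∂(∑ i ∈ s, c i • m i) = ∑ i ∈ s, (c i : ℂ) * ∫ x, f x ∂(m i) := by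
  rw [integral_finsetSum_measure fun i hi => (hf i hi).smul_measure_nnreal]
  refine Finset.sum_congr rfl fun i _ => ?_
  rw [integral_smul_nnreal_measure, NNReal.smul_def, Complex.real_smul]

theorem coe_toNNReal_sub_coe_toNNReal_neg (x : ℝ) :
    ((x.toNNReal : ℝ) : ℂ) - (((-x).toNNReal : ℝ) : ℂ) = x := by
  rw [← Complex.ofReal_sub, Real.coe_toNNReal', Real.coe_toNNReal', max_zero_sub_max_neg_zero_eq_self]

theorem integrable_exp_mul_I (m : Measure ℝ) [IsFiniteMeasure m] (t : ℝ) :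
    Integrable (fun x : ℝ => Complex.exp (t * x * Complex.I)) m := by
  refine (integrable_const (1 : ℝ)).mono' (by fun_prop) (ae_of_all _ fun x => ?_)
  rw [← Complex.ofReal_mul, Complex.norm_exp_ofReal_mul_I]

/-- The partial fraction expansion of the law of `∑ i ∈ s, a i * E i`. -/
theorem linLaw_add_sum_eq {ι : Type*} [Fintype ι] [DecidableEq ι] {s : Finset ι}
    (hs : s.Nonempty) {a : ι → ℝ} (ha : Set.InjOn a s) :
    linLaw s a + ∑ i ∈ s, (-fracCoeff s a i).toNNReal • linLaw {i} a =
      ∑ i ∈ s, (fracCoeff s a i).toNNReal • linLaw {i} a := by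
  -- The negative coefficients stand on the left, so both sides are finite positive measures and are
  -- determined by their characteristic functions.
  refine Measure.ext_of_charFun (funext fun t => ?_)
  have hint : ∀ i ∈ s, Integrable (fun x : ℝ => Complex.exp (t * x * Complex.I)) (linLaw {i} a) :=
    fun i _ => integrable_exp_mul_I _ t
  rw [charFun_apply_real, charFun_apply_real, integral_add_measure (integrable_exp_mul_I _ t)
    (integrable_exp_mul_I _ t), integral_sum_smul_measure s _ hint,
    integral_sum_smul_measure s _ hint]
  simp_rw [← charFun_apply_real, charFun_linLaw, Finset.prod_singleton]
  rw [prod_inv_one_sub_eq hs ha, ← Finset.sum_add_distrib]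
  refine Finset.sum_congr rfl fun i _ => ?_
  rw [← coe_toNNReal_sub_coe_toNNReal_neg (fracCoeff s a i)]
  ring

/-- The law of the sum is a summand of a positive combination of the one-variable laws, so
integrability is inherited from them. -/
theorem integrable_linLaw {ι : Type*} [Fintype ι] [DecidableEq ι] {s : Finset ι}
    (hs : s.Nonempty) {a : ι → ℝ} (ha : Set.InjOn a s) {f : ℝ → ℂ}
    (hf : ∀ i ∈ s, Integrable f (linLaw {i} a)) : Integrable f (linLaw s a) := by
  have h : Integrable f (∑ i ∈ s, (fracCoeff s a i).toNNReal • linLaw {i} a) :=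
    integrable_finsetSum_measure.2 fun i hi => (hf i hi).smul_measure_nnreal
  rw [← linLaw_add_sum_eq hs ha] at h
  exact h.left_of_add_measure

theorem integral_linLaw {ι : Type*} [Fintype ι] [DecidableEq ι] {s : Finset ι}
    (hs : s.Nonempty) {a : ι → ℝ} (ha : Set.InjOn a s) {f : ℝ → ℂ}
    (hf : ∀ i ∈ s, Integrable f (linLaw {i} a)) :
    ∫ x, f x ∂(linLaw s a) = ∑ i ∈ s, (fracCoeff s a i : ℂ) * ∫ x, f x ∂(linLaw {i} a) := by
  have h := congrArg (fun m => ∫ x, f x ∂m) (linLaw_add_sum_eq hs ha)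
  rw [integral_add_measure (integrable_linLaw hs ha hf)
    (integrable_finsetSum_measure.2 fun i hi => (hf i hi).smul_measure_nnreal),
    integral_sum_smul_measure s _ hf, integral_sum_smul_measure s _ hf] at h
  rw [eq_sub_of_add_eq h, ← Finset.sum_sub_distrib]
  refine Finset.sum_congr rfl fun i _ => ?_
  rw [← coe_toNNReal_sub_coe_toNNReal_neg (fracCoeff s a i)]
  ring

theorem linLaw_singleton {ι : Type*} [Fintype ι] (a : ι → ℝ) (i : ι) :
    linLaw {i} a = stdExp.map (a i * ·) := by
  have h : linForm {i} a = (a i * ·) ∘ Function.eval i := by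
    ext x
    simp [linForm]
  rw [linLaw, h, ← Measure.map_map (by fun_prop) (by fun_prop),
    (measurePreserving_eval (fun _ : ι => stdExp) i).map_eq]

/-! ### Divided differences as moments -/

/-- The divided difference of `x ↦ x ^ (w + #s - 1)` at the points `a i`, `i ∈ s`. -/
def divDiff {ι : Type*} [DecidableEq ι] (s : Finset ι) (w : ℂ) (a : ι → ℝ) : ℂ :=
  ∑ i ∈ s, (a i : ℂ) ^ (s.card - 1) * branchPow (a i) w / ∏ j ∈ s.erase i, ((a i : ℂ) - a j)

theorem integrable_branchPow_linForm {ι : Type*} [Fintype ι] [DecidableEq ι] {s : Finset ι}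
    (hs : s.Nonempty) {a : ι → ℝ} (ha : Set.InjOn a s) {ν : ℝ} (hν : -1 < ν) :
    Integrable (fun x => branchPow (linForm s a x) (ν : ℂ)) (piExp ι) := by
  have hm := measurable_branchPow ν
  have h : Integrable (fun y : ℝ => branchPow y (ν : ℂ)) (linLaw s a) := by
    refine integrable_linLaw hs ha fun i _ => ?_
    rw [linLaw_singleton, integrable_map_measure hm.aestronglyMeasurable (by fun_prop)]
    exact integrable_branchPow_stdExp hν (a i)
  rwa [linLaw, integrable_map_measure hm.aestronglyMeasurable
    (continuous_linForm s a).measurable.aemeasurable] at h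

theorem integral_branchPow_linForm {ι : Type*} [Fintype ι] [DecidableEq ι] {s : Finset ι}
    (hs : s.Nonempty) {a : ι → ℝ} (ha : Set.InjOn a s) {ν : ℝ} (hν : -1 < ν) :
    ∫ x, branchPow (linForm s a x) (ν : ℂ) ∂(piExp ι) = Real.Gamma (ν + 1) * divDiff s ν a := by
  have hm := measurable_branchPow ν
  rw [← integral_map (f := fun y : ℝ => branchPow y (ν : ℂ))
    (continuous_linForm s a).measurable.aemeasurable hm.aestronglyMeasurable]
  change ∫ y, _ ∂(linLaw s a) = _
  rw [integral_linLaw hs ha, divDiff, Finset.mul_sum]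
  · refine Finset.sum_congr rfl fun i _ => ?_
    rw [linLaw_singleton, integral_map (by fun_prop) hm.aestronglyMeasurable,
      integral_branchPow_stdExp hν, fracCoeff]
    push_cast
    ring
  · intro i _
    rw [linLaw_singleton, integrable_map_measure hm.aestronglyMeasurable (by fun_prop)]
    exact integrable_branchPow_stdExp hν (a i)

/-! ### Continuity of the moments and existence of the limit -/

theorem ae_piExp_pos (ι : Type*) [Fintype ι] : ∀ᵐ x ∂(piExp ι), ∀ i, 0 < x i :=
  eventually_all.2 fun i =>
    (Measure.tendsto_eval_ae_ae (μ := fun _ : ι => stdExp) (i := i)).eventually ae_stdExp_pos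

theorem piExp_pos_of_isOpen {ι : Type*} [Fintype ι] {U : Set (ι → ℝ)} (hU : IsOpen U)
    {x : ι → ℝ} (hx : x ∈ U) (h0 : ∀ i, 0 < x i) : 0 < piExp ι U := by
  obtain ⟨u, hu, hsub⟩ := isOpen_pi_iff'.1 hU x hx
  refine lt_of_lt_of_le ?_ (measure_mono hsub)
  rw [Measure.pi_pi, pos_iff_ne_zero, Finset.prod_ne_zero_iff]
  exact fun i _ => (stdExp_pos_of_isOpen (hu i).1 (hu i).2 (h0 i)).ne'

theorem continuous_uncurry_linForm {ι : Type*} (s : Finset ι) :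
    Continuous fun q : (ι → ℝ) × (ι → ℝ) => linForm s q.1 q.2 := by
  unfold linForm
  fun_prop

theorem continuous_integral_branchPow_linForm {ι : Type*} [Fintype ι] [DecidableEq ι]
    (s : Finset ι) {ν : ℝ} (hν : 0 < ν) :
    Continuous fun a : ι → ℝ => ∫ x, branchPow (linForm s a x) (ν : ℂ) ∂(piExp ι) := by
  rcases s.eq_empty_or_nonempty with rfl | hs
  · simpa [linForm] using continuous_const
  refine continuous_iff_continuousAt.2 fun a => ?_
  have hcont := continuous_branchPow hν
  -- The entries of `r` dominate $|b_i|$ for all `b` near `a`; the index shift makes them distinct,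
  -- so that the partial fraction argument gives an integrable majorant.
  let r : ι → ℝ := fun i => ∑ j, |a j| + 1 + (Fintype.equivFin ι i : ℕ)
  have hr : Function.Injective r := fun i j h =>
    (Fintype.equivFin ι).injective (Fin.ext (by exact_mod_cast add_left_cancel h))
  refine continuousAt_of_dominated (bound := fun x => ‖branchPow (linForm s r x) (ν : ℂ)‖)
    (Eventually.of_forall fun b => (hcont.comp (continuous_linForm s b)).aestronglyMeasurable) ?_
    (integrable_branchPow_linForm hs hr.injOn (by linarith)).norm
    (ae_of_all _ fun x => (hcont.comp ((continuous_uncurry_linForm s).comp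
      (Continuous.prodMk continuous_id continuous_const))).continuousAt)
  have hb : ∀ᶠ b in 𝓝 a, ∀ i, |b i| < |a i| + 1 := eventually_all.2 fun i =>
    (continuous_abs.comp (continuous_apply i)).continuousAt.eventually_lt
      continuousAt_const (lt_add_one |a i|)
  filter_upwards [hb] with b hb
  filter_upwards [ae_piExp_pos ι] with x hx
  have hbr : ∀ i, |b i| ≤ r i := fun i => by
    have h1 : |a i| ≤ ∑ j, |a j| :=
      Finset.single_le_sum (f := fun j => |a j|) (fun j _ => abs_nonneg _) (Finset.mem_univ i)
    have h2 : (0 : ℝ) ≤ (Fintype.equivFin ι i : ℕ) := Nat.cast_nonneg _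
    have h3 := hb i
    simp only [r]
    linarith
  have hle : |linForm s b x| ≤ linForm s r x := by
    refine (Finset.abs_sum_le_sum_abs _ _).trans (Finset.sum_le_sum fun i _ => ?_)
    rw [abs_mul, abs_of_pos (hx i)]
    exact mul_le_mul_of_nonneg_right (hbr i) (hx i).le
  have hpos : 0 < linForm s r x :=
    Finset.sum_pos (fun i _ => mul_pos (by simp only [r]; positivity) (hx i)) hs
  rw [branchPow_of_pos hpos, Complex.norm_real, Real.norm_of_nonneg (by positivity)]
  exact (norm_branchPow_le _ ν).trans (Real.rpow_le_rpow (abs_nonneg _) hle hν.le)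

theorem exists_tendsto_divDiff_of_pos {ι : Type*} [Fintype ι] [DecidableEq ι] (s : Finset ι)
    {ν : ℝ} (hν : 0 < ν) (a : ι → ℝ) :
    ∃ L, Tendsto (divDiff s (ν : ℂ)) (𝓝[{b : ι → ℝ | Function.Injective b}] a) (𝓝 L) := by
  rcases s.eq_empty_or_nonempty with rfl | hs
  · exact ⟨0, tendsto_const_nhds.congr fun b => by simp [divDiff]⟩
  have hΓ : (Real.Gamma (ν + 1) : ℂ) ≠ 0 := by
    exact_mod_cast (Real.Gamma_pos_of_pos (by linarith)).ne'
  refine ⟨_, ((((continuous_integral_branchPow_linForm s hν).tendsto a).div_const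
    (Real.Gamma (ν + 1) : ℂ)).mono_left nhdsWithin_le_nhds).congr' ?_⟩
  filter_upwards [self_mem_nhdsWithin] with b hb
  rw [integral_branchPow_linForm hs hb.injOn (by linarith), mul_div_cancel_left₀ _ hΓ]

/-- Trades a factor $b_k$ for exponents raised by one, which are positive when $\nu>-1$. The terms
at `k` agree, and elsewhere the identity is $\frac{x}{x-y}-1=\frac{y}{x-y}$. -/
theorem mul_divDiff {ι : Type*} [DecidableEq ι] {s : Finset ι} {k : ι} (hk : k ∈ s) (w : ℂ)
    {b : ι → ℝ} (hb : Function.Injective b) :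
    b k * divDiff s w b = divDiff s (w + 1) b - divDiff (s.erase k) (w + 1) b := by
  simp only [divDiff, branchPow_add_one]
  rw [Finset.card_erase_of_mem hk, ← Finset.add_sum_erase s _ hk, ← Finset.add_sum_erase s _ hk,
    add_sub_assoc, ← Finset.sum_sub_distrib, mul_add, Finset.mul_sum]
  congr 1
  · ring
  refine Finset.sum_congr rfl fun i hi => ?_
  obtain ⟨hik, his⟩ := Finset.mem_erase.1 hi
  -- The distinct indices `i` and `k` give `s` at least two elements, so the truncated subtraction
  -- is exact.
  have hcard : s.card - 1 = s.card - 1 - 1 + 1 := by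
    have := Finset.one_lt_card.2 ⟨i, his, k, hk, hik⟩
    omega
  have h1 : (b i : ℂ) - b k ≠ 0 := sub_ne_zero.2 fun h => hik (hb (Complex.ofReal_injective h))
  have h2 : ∏ j ∈ (s.erase k).erase i, ((b i : ℂ) - b j) ≠ 0 :=
    Finset.prod_ne_zero_iff.2 fun j hj => sub_ne_zero.2 fun h =>
      (Finset.mem_erase.1 hj).1 (hb (Complex.ofReal_injective h)).symm
  rw [← Finset.mul_prod_erase (s.erase i) _ (Finset.mem_erase.2 ⟨hik.symm, hk⟩),
    Finset.erase_right_comm, hcard, pow_succ]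
  simp only [Nat.add_sub_cancel]
  generalize ∏ j ∈ (s.erase k).erase i, ((b i : ℂ) - b j) = y at h2 ⊢
  field_simp
  ring

theorem exists_tendsto_divDiff {ι : Type*} [Fintype ι] [DecidableEq ι] {ν : ℝ} (hν : -1 < ν)
    {a : ι → ℝ} (ha : a ≠ 0) :
    ∃ L, Tendsto (divDiff Finset.univ (ν : ℂ)) (𝓝[{b : ι → ℝ | Function.Injective b}] a)
      (𝓝 L) := by
  obtain ⟨k, hk⟩ := Function.ne_iff.1 ha
  obtain ⟨L, hL⟩ := exists_tendsto_divDiff_of_pos Finset.univ (ν := ν + 1) (by linarith) a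
  obtain ⟨M, hM⟩ := exists_tendsto_divDiff_of_pos (Finset.univ.erase k) (ν := ν + 1)
    (by linarith) a
  have hc : Tendsto (fun b : ι → ℝ => (b k : ℂ)) (𝓝[{b | Function.Injective b}] a) (𝓝 (a k)) :=
    ((Complex.continuous_ofReal.comp (continuous_apply k)).tendsto a).mono_left nhdsWithin_le_nhds
  have hk' : (a k : ℂ) ≠ 0 := by exact_mod_cast hk
  refine ⟨_, ((hL.sub hM).div hc hk').congr' ?_⟩
  filter_upwards [self_mem_nhdsWithin, hc.eventually_ne hk'] with b hb hbk
  push_cast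
  rw [Pi.div_apply, ← mul_divDiff (Finset.mem_univ k) _ hb, mul_div_cancel_left₀ _ hbk]

/-! ### The bialternant as a divided difference -/

theorem bialternant_eq_divDiff {m : ℕ} (w : ℂ) {b : Fin (m + 1) → ℝ}
    (hb : Function.Injective b) : bialternant w b = divDiff Finset.univ w b := by
  have hv : Function.Injective fun i => (b i : ℂ) := Complex.ofReal_injective.comp hb
  have hdet : (Matrix.vandermonde fun i => (b i : ℂ)).det ≠ 0 :=
    Matrix.det_vandermonde_ne_zero_iff.2 hv
  -- By Cramer's rule the bialternant is the top coefficient of the polynomial interpolating `f`,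
  -- which Lagrange's formula turns into the divided difference.
  let f : Fin (m + 1) → ℂ := fun i => branchPow (b i) (w + m)
  let p : Polynomial ℂ := Lagrange.interpolate Finset.univ (fun i => (b i : ℂ)) f
  have hp : p.degree < (Finset.univ : Finset (Fin (m + 1))).card :=
    Lagrange.degree_interpolate_lt f hv.injOn
  have hpe : ∀ i, p.eval (b i : ℂ) = f i := fun i =>
    Lagrange.eval_interpolate_at_node f hv.injOn (Finset.mem_univ i)
  have hf : (Matrix.vandermonde fun i => (b i : ℂ)).mulVec (fun j => p.coeff j) = f := by
    ext i
    have hnat : p.natDegree < m + 1 := by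
      rcases eq_or_ne p 0 with h | h
      · simp [h]
      · simpa using (Polynomial.natDegree_lt_iff_degree_lt h).2 hp
    rw [← hpe i, Polynomial.eval_eq_sum_range' hnat, ← Fin.sum_univ_eq_sum_range
      (fun j => p.coeff j * (b i : ℂ) ^ j)]
    simp [Matrix.mulVec, dotProduct, Matrix.vandermonde_apply, mul_comm]
  have hJ : jacobiMatrix w b =
      (Matrix.vandermonde fun i => (b i : ℂ)).updateCol (Fin.last m) f := by
    ext i j
    by_cases hj : j = Fin.last m
    · subst hj
      simp [jacobiMatrix, f, add_sub_assoc]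
    · have : (j : ℕ) ≠ m := fun h => hj (Fin.ext h)
      simp [jacobiMatrix, hj, this, Matrix.vandermonde_apply]
  rw [bialternant, hJ, ← Matrix.cramer_apply, ← hf, Matrix.cramer_eq_adjugate_mulVec,
    Matrix.mulVec_mulVec, Matrix.adjugate_mul, Matrix.smul_mulVec, Matrix.one_mulVec,
    Pi.smul_apply, smul_eq_mul, mul_div_cancel_left₀ _ hdet]
  have h := Lagrange.coeff_eq_sum hv.injOn hp
  simp only [Finset.card_univ, Fintype.card_fin, Nat.add_sub_cancel] at h
  rw [Fin.val_last, h, divDiff]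
  refine Finset.sum_congr rfl fun i _ => ?_
  rw [hpe i, Finset.card_univ, Fintype.card_fin, Nat.add_sub_cancel, ← branchPow_add_natCast]

/-! ### Passing signs to the limit -/

/-- Moving from `a` along `v` separates equal entries at once and keeps distinct ones apart for
small $\varepsilon$. The set `T` allows the approach to stay inside an orthant. -/
theorem neBot_nhdsWithin_injective_inter {n : ℕ} {a v : Fin n → ℝ} (hv : Function.Injective v)
    {T : Set (Fin n → ℝ)} (hT : ∀ ε : ℝ, 0 < ε → a + ε • v ∈ T) :
    NeBot (𝓝[{b | Function.Injective b} ∩ T] a) := by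
  have hcont : Continuous fun ε : ℝ => a + ε • v := by fun_prop
  have h : Tendsto (fun ε : ℝ => a + ε • v) (𝓝[>] 0)
      (𝓝[{b | Function.Injective b} ∩ T] a) := by
    refine tendsto_nhdsWithin_iff.2 ⟨?_, ?_⟩
    · simpa using (hcont.tendsto 0).mono_left nhdsWithin_le_nhds
    have hinj : ∀ᶠ ε : ℝ in 𝓝[>] 0, ∀ i j, i ≠ j → (a + ε • v) i ≠ (a + ε • v) j := by
      refine eventually_all.2 fun i => eventually_all.2 fun j => ?_
      rcases eq_or_ne (a i) (a j) with hij | hij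
      · filter_upwards [self_mem_nhdsWithin] with ε hε hne
        simpa [hij, (Set.mem_Ioi.1 hε).ne'] using hv.ne hne
      · have h0 : ContinuousAt (fun ε : ℝ => (a + ε • v) i - (a + ε • v) j) 0 :=
          (((continuous_apply i).comp hcont).sub ((continuous_apply j).comp hcont)).continuousAt
        have h1 := h0.eventually_ne (y := 0) (by simpa [sub_eq_zero] using hij)
        filter_upwards [nhdsWithin_le_nhds h1] with ε hε _
        exact sub_ne_zero.1 hε
    filter_upwards [hinj, self_mem_nhdsWithin] with ε h1 h2
    exact ⟨fun i j hij => by_contra fun hne => h1 i j hne hij, hT ε h2⟩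
  exact h.neBot

/-- The factor `c` is a sign, so that positive and negative real parts are treated together. -/
theorem Gamma_mul_re_divDiff {n : ℕ} (hn : 0 < n) {ν : ℝ} (hν : -1 < ν) {b : Fin n → ℝ}
    (hb : Function.Injective b) (c : ℝ) :
    Real.Gamma (ν + 1) * (c * (divDiff Finset.univ (ν : ℂ) b).re) =
      ∫ x, c * (branchPow (linForm Finset.univ b x) (ν : ℂ)).re ∂(piExp (Fin n)) := by
  have : Nonempty (Fin n) := ⟨⟨0, hn⟩⟩
  have h := congrArg Complex.re
    (integral_branchPow_linForm Finset.univ_nonempty hb.injOn (s := Finset.univ) hν)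
  rw [Complex.re_ofReal_mul, ← RCLike.re_eq_complex_re, ← integral_re
    (integrable_branchPow_linForm Finset.univ_nonempty hb.injOn hν)] at h
  rw [integral_const_mul, mul_left_comm]
  exact congrArg _ h.symm

theorem mul_re_nonneg_of_tendsto_divDiff {n : ℕ} (hn : 0 < n) {ν : ℝ} (hν : -1 < ν)
    {a : Fin n → ℝ} {L : ℂ} {T : Set (Fin n → ℝ)} [NeBot (𝓝[{b | Function.Injective b} ∩ T] a)]
    (hL : Tendsto (divDiff Finset.univ (ν : ℂ)) (𝓝[{b | Function.Injective b}] a) (𝓝 L)) {c : ℝ}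
    (hT : ∀ b ∈ T, ∀ x : Fin n → ℝ, (∀ i, 0 < x i) →
      0 ≤ c * (branchPow (linForm Finset.univ b x) (ν : ℂ)).re) :
    0 ≤ c * L.re := by
  have hL' := ((Complex.continuous_re.tendsto L).comp
    (hL.mono_left (nhdsWithin_mono a (Set.inter_subset_left (t := T))))).const_mul c
  refine ge_of_tendsto hL' ?_
  filter_upwards [self_mem_nhdsWithin] with b hb
  have hΓ : 0 < Real.Gamma (ν + 1) := Real.Gamma_pos_of_pos (by linarith)
  refine nonneg_of_mul_nonneg_right (b := c * _) ?_ hΓ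
  refine (Gamma_mul_re_divDiff hn hν hb.1 c).symm ▸ integral_nonneg_of_ae ?_
  filter_upwards [ae_piExp_pos (Fin n)] with x hx using hT b hb.2 x hx

/-- Continuity at $(a,x_0)$ keeps the integrand above some $\delta>0$ for `b` near `a` and `x` in an
open set `V` around $x_0$. The moments are then at least $\delta$ times the mass of `V`, uniformly
in `b`, and so is their limit. -/
theorem mul_re_pos_of_tendsto_divDiff {n : ℕ} (hn : 0 < n) {ν : ℝ} (hν : -1 < ν)
    {a : Fin n → ℝ} {L : ℂ} {T : Set (Fin n → ℝ)} [NeBot (𝓝[{b | Function.Injective b} ∩ T] a)]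
    (hL : Tendsto (divDiff Finset.univ (ν : ℂ)) (𝓝[{b | Function.Injective b}] a) (𝓝 L)) {c : ℝ}
    (hT : ∀ b ∈ T, ∀ x : Fin n → ℝ, (∀ i, 0 < x i) →
      0 ≤ c * (branchPow (linForm Finset.univ b x) (ν : ℂ)).re)
    {x₀ : Fin n → ℝ} (hx₀ : ∀ i, 0 < x₀ i) (hne : linForm Finset.univ a x₀ ≠ 0)
    (hpos : 0 < c * (branchPow (linForm Finset.univ a x₀) (ν : ℂ)).re) :
    0 < c * L.re := by
  have : Nonempty (Fin n) := ⟨⟨0, hn⟩⟩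
  have hΓ : 0 < Real.Gamma (ν + 1) := Real.Gamma_pos_of_pos (by linarith)
  obtain ⟨δ, hδ, hδc⟩ := exists_between hpos
  have hcont : ContinuousAt (fun q : (Fin n → ℝ) × (Fin n → ℝ) =>
      c * (branchPow (linForm Finset.univ q.1 q.2) (ν : ℂ)).re) (a, x₀) :=
    continuousAt_const.mul (Complex.continuous_re.continuousAt.comp
      (ContinuousAt.comp (x := (a, x₀)) (f := fun q : (Fin n → ℝ) × (Fin n → ℝ) =>
          linForm Finset.univ q.1 q.2) (continuousAt_branchPow hne ν)
        (continuous_uncurry_linForm Finset.univ).continuousAt))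
  have hev : ∀ᶠ q in 𝓝 a ×ˢ 𝓝 x₀, δ < c * (branchPow (linForm Finset.univ q.1 q.2) (ν : ℂ)).re := by
    rw [← nhds_prod_eq]
    exact hcont.eventually_const_lt hδc
  obtain ⟨pa, hpa, px, hpx, hp⟩ := eventually_prod_iff.1 hev
  obtain ⟨V, hVp, hV, hxV⟩ := eventually_nhds_iff.1 hpx
  have hVpos : 0 < (piExp (Fin n)).real V :=
    ENNReal.toReal_pos (piExp_pos_of_isOpen hV hxV hx₀).ne' (measure_ne_top _ _)
  have hL' := (((Complex.continuous_re.tendsto L).comp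
    (hL.mono_left (nhdsWithin_mono a (Set.inter_subset_left (t := T))))).const_mul c).const_mul
      (Real.Gamma (ν + 1))
  refine pos_of_mul_pos_right ((mul_pos hVpos hδ).trans_le (ge_of_tendsto hL' ?_)) hΓ.le
  filter_upwards [self_mem_nhdsWithin, nhdsWithin_le_nhds hpa] with b hb hba
  refine le_of_le_of_eq ?_ (Gamma_mul_re_divDiff hn hν hb.1 c).symm
  rw [← smul_eq_mul, ← integral_indicator_const δ hV.measurableSet]
  refine integral_mono_ae ((integrable_const δ).indicator hV.measurableSet)
    ((integrable_branchPow_linForm Finset.univ_nonempty hb.1.injOn hν).re.const_mul c) ?_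
  filter_upwards [ae_piExp_pos (Fin n)] with x hx
  by_cases hxV : x ∈ V
  · rw [Set.indicator_of_mem hxV]
    exact (hp hba (hVp x hxV)).le
  · rw [Set.indicator_of_notMem hxV]
    exact hT b hb.2 x hx

theorem exists_linForm_ne_zero {n : ℕ} {a : Fin n → ℝ} (ha : a ≠ 0) :
    ∃ x : Fin n → ℝ, (∀ i, 0 < x i) ∧ linForm Finset.univ a x ≠ 0 := by
  obtain ⟨k, hk⟩ := Function.ne_iff.1 ha
  by_cases h : ∑ i, a i = 0
  -- When the entries sum to zero, doubling the weight at `k` leaves the value $a_k\ne0$.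
  · refine ⟨fun i => 1 + if i = k then 1 else 0, fun i => by positivity, ?_⟩
    simpa [linForm, mul_add, Finset.sum_add_distrib, h] using hk
  · exact ⟨1, fun i => one_pos, by simpa [linForm] using h⟩

theorem tendsto_bialternant {n : ℕ} {ν : ℝ} (hν : -1 < ν) {a : Fin n → ℝ} (ha : a ≠ 0) :
    Tendsto (bialternant (ν : ℂ)) (𝓝[{b : Fin n → ℝ | Function.Injective b}] a)
      (𝓝 (fracHsymm (ν : ℂ) a)) := by
  obtain _ | m := n
  · exact absurd (Subsingleton.elim a 0) ha
  obtain ⟨L, hL⟩ := exists_tendsto_divDiff hν ha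
  have hB : Tendsto (bialternant (ν : ℂ)) (𝓝[{b : Fin (m + 1) → ℝ | Function.Injective b}] a)
      (𝓝 L) := hL.congr' <| by
    filter_upwards [self_mem_nhdsWithin] with b hb using (bialternant_eq_divDiff _ hb).symm
  have : NeBot (𝓝[{b : Fin (m + 1) → ℝ | Function.Injective b}] a) := by
    simpa using neBot_nhdsWithin_injective_inter (a := a) (T := Set.univ)
      (v := fun i => ((i : ℕ) : ℝ)) (fun i j h => Fin.ext (Nat.cast_injective h)) (by simp)
  have hLa : fracHsymm (ν : ℂ) a = L := by
    rw [fracHsymm]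
    split_ifs with h
    -- At distinct entries `a` itself lies in the approach set, so the limit must equal the value
    -- there.
    · exact tendsto_nhds_unique (tendsto_pure_nhds _ a)
        (hB.mono_left (pure_le_nhdsWithin (Set.mem_ofPred.2 h)))
    · exact hB.limUnder_eq
  rwa [hLa]

theorem linForm_nonneg {ι : Type*} {s : Finset ι} {b x : ι → ℝ} (hb : ∀ i, 0 ≤ b i)
    (hx : ∀ i, 0 < x i) : 0 ≤ linForm s b x :=
  Finset.sum_nonneg fun i _ => mul_nonneg (hb i) (hx i).le

theorem linForm_nonpos {ι : Type*} {s : Finset ι} {b x : ι → ℝ} (hb : ∀ i, b i ≤ 0)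
    (hx : ∀ i, 0 < x i) : linForm s b x ≤ 0 :=
  Finset.sum_nonpos fun i _ => mul_nonpos_of_nonpos_of_nonneg (hb i) (hx i).le

theorem cos_mul_pi_pos {δ : ℝ} (hδ : |δ| < 1 / 2) : 0 < Real.cos (δ * Real.pi) := by
  obtain ⟨h1, h2⟩ := abs_lt.1 hδ
  have := Real.pi_pos
  exact Real.cos_pos_of_mem_Ioo ⟨by nlinarith, by nlinarith⟩

end

theorem theorem2 (n : ℕ) (μ : ℝ) (hμ : -1 < μ) (a : Fin n → ℝ) (ha : a ≠ 0) :
    -- the limit that defines `h_μ (a)` exists, and it is also the value at distinct entries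
    Tendsto (bialternant (μ : ℂ)) (𝓝[{b : Fin n → ℝ | Function.Injective b}] a)
      (𝓝 (fracHsymm (μ : ℂ) a)) ∧
    -- (a)
    ((∃ p : ℕ, |μ - 2 * (p : ℝ)| < 1 / 2) → 0 < (fracHsymm (μ : ℂ) a).re) ∧
    -- (b)
    ((∃ p : ℕ, |μ - (2 * (p : ℝ) - 1)| < 1 / 2) →
      ((∀ i, 0 ≤ a i) → 0 < (fracHsymm (μ : ℂ) a).re) ∧
      ((∀ i, a i ≤ 0) → (fracHsymm (μ : ℂ) a).re < 0)) ∧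
    -- (c)
    ((∃ p : ℕ, |μ - (p : ℝ)| = 1 / 2) →
      0 ≤ (fracHsymm (μ : ℂ) a).re ∧
      ((∀ i, a i ≤ 0) → (fracHsymm (μ : ℂ) a).re = 0)) := by
  have hlim := tendsto_bialternant hμ ha
  obtain _ | m := n
  · exact absurd (Subsingleton.elim a 0) ha
  have hn := m.succ_pos
  have hL : Tendsto (divDiff Finset.univ (μ : ℂ))
      (𝓝[{b : Fin (m + 1) → ℝ | Function.Injective b}] a) (𝓝 (fracHsymm (μ : ℂ) a)) :=
    hlim.congr' <| by
      filter_upwards [self_mem_nhdsWithin] with b hb using bialternant_eq_divDiff _ hb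
  obtain ⟨x₀, hx₀, hne⟩ := exists_linForm_ne_zero ha
  have hv : Function.Injective fun i : Fin (m + 1) => ((i : ℕ) : ℝ) :=
    fun i j h => Fin.ext (Nat.cast_injective h)
  -- The opposite direction keeps the approach inside the nonpositive orthant.
  have hv' : Function.Injective fun i : Fin (m + 1) => -((i : ℕ) : ℝ) := neg_injective.comp hv
  have huniv : NeBot (𝓝[{b : Fin (m + 1) → ℝ | Function.Injective b} ∩ Set.univ] a) :=
    neBot_nhdsWithin_injective_inter hv (by simp)
  have hnonneg : (∀ i, 0 ≤ a i) → NeBot (𝓝[{b : Fin (m + 1) → ℝ | Function.Injective b} ∩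
      {b | ∀ i, 0 ≤ b i}] a) := fun h =>
    neBot_nhdsWithin_injective_inter hv fun ε hε i =>
      add_nonneg (h i) (mul_nonneg hε.le (Nat.cast_nonneg _))
  have hnonpos : (∀ i, a i ≤ 0) → NeBot (𝓝[{b : Fin (m + 1) → ℝ | Function.Injective b} ∩
      {b | ∀ i, b i ≤ 0}] a) := fun h =>
    neBot_nhdsWithin_injective_inter hv' fun ε hε i =>
      add_nonpos (h i) (mul_nonpos_of_nonneg_of_nonpos hε.le (neg_nonpos.2 (Nat.cast_nonneg _)))
  have hpow : ∀ y : ℝ, 0 < y → 0 < y ^ μ := fun y hy => Real.rpow_pos_of_pos hy μ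
  refine ⟨hlim, ?_, ?_, ?_⟩
  · rintro ⟨p, hp⟩
    have hcos : 0 < Real.cos (μ * Real.pi) := by
      have h : μ * Real.pi = (μ - 2 * p) * Real.pi + p * (2 * Real.pi) := by ring
      rw [h, Real.cos_add_nat_mul_two_pi]
      exact cos_mul_pi_pos hp
    have hre : ∀ y : ℝ, y ≠ 0 → 0 < 1 * (branchPow y (μ : ℂ)).re := fun y hy => by
      rw [one_mul]
      rcases hy.lt_or_gt with hy | hy
      · rw [re_branchPow_of_neg hy]
        exact mul_pos (hpow _ (neg_pos.2 hy)) hcos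
      · rw [re_branchPow_of_pos hy]
        exact hpow y hy
    rw [← one_mul (Complex.re _)]
    refine mul_re_pos_of_tendsto_divDiff (T := Set.univ) hn hμ hL (fun b _ x _ => ?_) hx₀ hne
      (hre _ hne)
    -- Where the form vanishes the power is $0$ by convention, so only the weak inequality holds
    -- everywhere.
    rcases eq_or_ne (linForm Finset.univ b x) 0 with h | h
    · simp [h, branchPow_zero_left]
    · exact (hre _ h).le
  · rintro ⟨p, hp⟩
    have hcos : Real.cos (μ * Real.pi) < 0 := by
      have h : μ * Real.pi = (μ - (2 * p - 1)) * Real.pi - Real.pi + p * (2 * Real.pi) := by ring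
      rw [h, Real.cos_add_nat_mul_two_pi, Real.cos_sub_pi]
      exact neg_neg_of_pos (cos_mul_pi_pos hp)
    refine ⟨fun h => ?_, fun h => ?_⟩
    · have := hnonneg h
      have hre : ∀ y : ℝ, 0 < y → 0 < 1 * (branchPow y (μ : ℂ)).re := fun y hy => by
        rw [one_mul, re_branchPow_of_pos hy]
        exact hpow y hy
      rw [← one_mul (Complex.re _)]
      refine mul_re_pos_of_tendsto_divDiff (T := {b | ∀ i, 0 ≤ b i}) hn hμ hL
        (fun b hb x hx => ?_) hx₀ hne (hre _ ((linForm_nonneg h hx₀).lt_of_ne' hne))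
      rcases (linForm_nonneg (s := Finset.univ) hb hx).eq_or_lt with h | h
      · simp [← h, branchPow_zero_left]
      · exact (hre _ h).le
    · have := hnonpos h
      have hre : ∀ y : ℝ, y < 0 → 0 < -1 * (branchPow y (μ : ℂ)).re := fun y hy => by
        rw [re_branchPow_of_neg hy]
        have := mul_neg_of_pos_of_neg (hpow _ (neg_pos.2 hy)) hcos
        linarith
      suffices 0 < -1 * (fracHsymm (μ : ℂ) a).re by linarith
      refine mul_re_pos_of_tendsto_divDiff (T := {b | ∀ i, b i ≤ 0}) hn hμ hL
        (fun b hb x hx => ?_) hx₀ hne (hre _ ((linForm_nonpos h hx₀).lt_of_ne hne))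
      rcases (linForm_nonpos (s := Finset.univ) hb hx).eq_or_lt with h | h
      · simp [h, branchPow_zero_left]
      · exact (hre _ h).le
  · rintro ⟨p, hp⟩
    have hcos : Real.cos (μ * Real.pi) = 0 := by
      rw [Real.cos_eq_zero_iff]
      rcases eq_or_eq_neg_of_abs_eq hp with h | h
      · refine ⟨p, ?_⟩
        rw [eq_add_of_sub_eq h]
        push_cast
        ring
      · refine ⟨p - 1, ?_⟩
        rw [eq_add_of_sub_eq h]
        push_cast
        ring
    have hre_nonpos : ∀ y : ℝ, y ≤ 0 → (branchPow y (μ : ℂ)).re = 0 := fun y hy => by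
      rcases hy.eq_or_lt with rfl | hy
      · simp [branchPow_zero_left]
      · rw [re_branchPow_of_neg hy, hcos, mul_zero]
    refine ⟨?_, fun h => ?_⟩
    · rw [← one_mul (Complex.re _)]
      refine mul_re_nonneg_of_tendsto_divDiff (T := Set.univ) hn hμ hL fun b _ x _ => ?_
      rw [one_mul]
      rcases le_or_gt (linForm Finset.univ b x) 0 with h | h
      · exact (hre_nonpos _ h).ge
      · rw [re_branchPow_of_pos h]
        exact (hpow _ h).le
    · have := hnonpos h
      -- The integrand vanishes identically, so the weak inequality holds for both signs of `c`.
      have key : ∀ c : ℝ, 0 ≤ c * (fracHsymm (μ : ℂ) a).re := fun c =>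
        mul_re_nonneg_of_tendsto_divDiff (T := {b | ∀ i, b i ≤ 0}) hn hμ hL fun b hb x hx => by
          rw [hre_nonpos _ (linForm_nonpos hb hx), mul_zero]
      linarith [key 1, key (-1)]
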